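/- For a vector $x\in\mathbb{R}^n$, let $s^-(x)$ denote the number of sign variations in $x$ after deleting all its zero entries (with $s^-(0):=0$), and let $s^+(x)$ denote the maximal possible number of sign variations in $x$ after setting every zero entry of $x$ to either $-1$ or $+1$. A matrix $A\in\mathbb{R}^{n\times n}$ is called a Jacobi matrix if it is tridiagonal with positive entries on the super- and sub-diagonals. Proposition. Let $A\in\mathbb{R}^{n\times n}$ be a constant matrix. The following two conditions are equivalent: 1. $A$ is a Jacobi matrix. 2. For every $x_0\in\mathbb{R}^n\setminus\{0\}$, the solution $x(t,x_0)$ of the linear time-invariant system $\dot x(t)=Ax(t)$, $x(0)=x_0$, satisfies $$s^+(x(t,x_0))\le s^-(x_0)\quad\text{for all } t>0.$$ -/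

import Mathlib

open scoped Matrix

/-- `s⁻(x)`: the number of sign variations in `x` after deleting all its zero entries.
Two entries `x i`, `x j` with `i < j` are neighbours after the deletion iff both are nonzero and
all the entries strictly between them vanish; they contribute a sign variation iff moreover
they have opposite signs. In particular `s⁻(0) = 0`. -/
noncomputable def sMinus {n : ℕ} (x : Fin n → ℝ) : ℕ :=
  {p : Fin n × Fin n | p.1 < p.2 ∧ x p.1 * x p.2 < 0 ∧
    ∀ k, p.1 < k → k < p.2 → x k = 0}.ncard

/-- The vector obtained from `x` by setting every zero entry `x i` to `e i`, where `e i = ±1`. -/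
noncomputable def fillZeros {n : ℕ} (x : Fin n → ℝ) (e : Fin n → ℤˣ) : Fin n → ℝ :=
  fun i => if x i = 0 then ((e i : ℤ) : ℝ) else x i

/-- `s⁺(x)`: the maximal number of sign variations in `x` over all ways of setting every zero
entry of `x` to either `-1` or `+1` (a maximum over a finite nonempty set). -/
noncomputable def sPlus {n : ℕ} (x : Fin n → ℝ) : ℕ :=
  Finset.univ.sup fun e : Fin n → ℤˣ => sMinus (fillZeros x e)

/-- `A` is a Jacobi matrix: tridiagonal, with positive entries on the superdiagonal and on the
subdiagonal. -/
def IsJacobi {n : ℕ} (A : Matrix (Fin n) (Fin n) ℝ) : Prop :=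
  (∀ i j : Fin n, (i : ℕ) + 1 < j ∨ (j : ℕ) + 1 < i → A i j = 0) ∧
  (∀ i j : Fin n, (j : ℕ) = i + 1 → 0 < A i j ∧ 0 < A j i)

/-- `x` solves the linear time-invariant system `ẋ(t) = A x(t)` on `[0, ∞)`, with `x(0) = x₀`. -/
def IsLTISolution {n : ℕ} (A : Matrix (Fin n) (Fin n) ℝ) (x₀ : Fin n → ℝ)
    (x : ℝ → Fin n → ℝ) : Prop :=
  x 0 = x₀ ∧ ∀ t : ℝ, 0 ≤ t → HasDerivWithinAt x (A *ᵥ x t) (Set.Ici 0) t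

/-!
The solution with initial value `v` is `exp (t A) v`, so the theorem is a statement about sign
variations of vectors under the matrices `exp (t A)`, `t > 0`.

**Sign variations as alternations.** For `x ≠ 0`, `s⁻(x) ≥ k` means that `k + 1` entries
of `x` at increasing positions are nonzero with alternating signs, and `s⁺(x) ≥ k` means the same
with zeros allowed to carry either sign (`HasAlternation` with `0 < ·` and `0 ≤ ·`). In this form strict alternations are
an open condition on `x`, and weak ones a closed condition.

**A Jacobi matrix diminishes variations.** Adding to one entry a nonnegative multiple of an adjacent
entry creates no alternation, strict or weak (`HasAlternation.of_add_adjacent`), and neither does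
rescaling an entry by a positive factor. Hence, for small `h > 0`, the elementary matrices
`1 + h A_ij E_ij` lie in the monoid of matrices that create no strict alternation, and the matrices
`1 - h A_ij E_ij` in the monoid of those that destroy no weak one. By Chernoff's product formula
(`tendsto_pow_exp_of_hasDerivAt`), `exp (t A)` and `exp (-t A)` are limits of products of such
matrices, so openness and closedness give, for the solution `x`: strict alternations of `x r` are
already present in `x 0`, and weak alternations of `x t` are already present in `x r`, `r < t`.
The two facts are glued at an intermediate time `r` at which weak alternations are strict. By
analyticity one can choose `r` such that `x r i = 0` only if the derivative `(A x r) i` is zero too;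
since `A` is Jacobi, such a zero entry must lie between two entries of opposite signs
(`IsJacobi.hasAlternation_pos_of_nonneg`), and it can be replaced in an alternation by one of them.

**Conversely**, the initial value `e_j` shows `A_ij ≥ 0` for `i ≠ j`: otherwise the entries `i`, `j`
would have opposite signs for small times. If `k` lies strictly between `i` and `j` and `A_ij > 0`,
the initial value `e_j - c e_k` with small `c > 0` has one variation but acquires the signs `+ - +`
at `i`, `k`, `j`. If finally `A_ij = 0` for adjacent `i`, `j`, then `A` is block triangular, the
`i`-th entry of `exp (t A) e_j` stays zero, and `s⁺` is at least `1` while `s⁻(e_j) = 0`.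
-/

open Filter Topology

/-! ### Chernoff's product formula -/

/-- Stated with the factor `d` so that the case `m = 0` does not need `‖1‖ = 1`. -/
theorem norm_pow_mul_le {𝔸 : Type*} [NormedRing 𝔸] {a : 𝔸} {C : ℝ} (ha : ‖a‖ ≤ C) (d : 𝔸)
    (m : ℕ) :
    ‖a ^ m * d‖ ≤ C ^ m * ‖d‖ := by
  induction m with
  | zero => simp
  | succ m ih =>
    have hC : 0 ≤ C := (norm_nonneg a).trans ha
    calc ‖a ^ (m + 1) * d‖ = ‖a * (a ^ m * d)‖ := by rw [pow_succ', mul_assoc]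
      _ ≤ ‖a‖ * ‖a ^ m * d‖ := norm_mul_le _ _
      _ ≤ C * (C ^ m * ‖d‖) := by gcongr
      _ = C ^ (m + 1) * ‖d‖ := by ring

theorem norm_pow_sub_pow_le {𝔸 : Type*} [NormedRing 𝔸] {a b : 𝔸} {C : ℝ} (hC : 1 ≤ C)
    (ha : ‖a‖ ≤ C) (hb : ‖b‖ ≤ C) (m : ℕ) :
    ‖a ^ m - b ^ m‖ ≤ m * C ^ m * ‖a - b‖ := by
  induction m with
  | zero => simp
  | succ m ih =>
    calc ‖a ^ (m + 1) - b ^ (m + 1)‖ = ‖a ^ m * (a - b) + (a ^ m - b ^ m) * b‖ := by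
          congr 1; noncomm_ring
      _ ≤ C ^ m * ‖a - b‖ + (m * C ^ m * ‖a - b‖) * C := by
          refine (norm_add_le _ _).trans (add_le_add (norm_pow_mul_le ha _ m) ?_)
          refine (norm_mul_le _ _).trans ?_
          gcongr
      _ ≤ C ^ (m + 1) * ‖a - b‖ + (m * C ^ m * ‖a - b‖) * C := by
          gcongr
          exact Nat.le_succ m
      _ = ((m + 1 : ℕ) : ℝ) * C ^ (m + 1) * ‖a - b‖ := by push_cast; ring

/-- Chernoff's product formula in a Banach algebra: a differentiable curve through `1` with
velocity `A` generates the exponential of `A`. -/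
theorem tendsto_pow_exp_of_hasDerivAt {𝔸 : Type*} [NormedRing 𝔸] [NormedAlgebra ℝ 𝔸]
    [NormOneClass 𝔸] [CompleteSpace 𝔸] {F : ℝ → 𝔸} {A : 𝔸} (h0 : F 0 = 1)
    (hF : HasDerivAt F A 0) {t : ℝ} (ht : 0 < t) :
    Tendsto (fun m : ℕ => F (t / m) ^ m) atTop (𝓝 (NormedSpace.exp (t • A))) := by
  -- `F` and `G` agree to first order at `0`, so `m` steps of length `t / m` differ by `o(1)`
  set G : ℝ → 𝔸 := fun h => NormedSpace.exp (h • A) with hG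
  have hG0 : G 0 = 1 := by simp [hG]
  have hGd : HasDerivAt G A 0 := by
    simpa using hasDerivAt_exp_smul_const (𝕂 := ℝ) A 0
  have htm : Tendsto (fun m : ℕ => t / (m : ℝ)) atTop (𝓝 0) :=
    tendsto_const_div_atTop_nhds_zero_nat t
  have bound : ∀ H : ℝ → 𝔸, H 0 = 1 → HasDerivAt H A 0 →
      ∃ c : ℝ, ∀ᶠ h in 𝓝 (0 : ℝ), 0 < h → ‖H h‖ ≤ Real.exp (c * h) := by
    intro H H0 hH
    obtain ⟨c, hc⟩ := hH.isBigO_sub.bound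
    refine ⟨c, hc.mono fun h hh hpos => ?_⟩
    rw [H0, sub_zero, Real.norm_eq_abs, abs_of_pos hpos] at hh
    calc ‖H h‖ = ‖(H h - 1) + 1‖ := by simp
      _ ≤ ‖H h - 1‖ + 1 := by simpa using norm_add_le (H h - 1) 1
      _ ≤ c * h + 1 := by gcongr
      _ ≤ Real.exp (c * h) := Real.add_one_le_exp _
  obtain ⟨c₁, hc₁⟩ := bound F h0 hF
  obtain ⟨c₂, hc₂⟩ := bound G hG0 hGd
  set c := max (max c₁ c₂) 0
  have hpowG : ∀ᶠ m : ℕ in atTop, G (t / m) ^ m = NormedSpace.exp (t • A) := by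
    filter_upwards [eventually_gt_atTop 0] with m hm
    let : NormedAlgebra ℚ 𝔸 := NormedAlgebra.restrictScalars ℚ ℝ 𝔸
    rw [hG]
    simp only
    rw [← NormedSpace.exp_nsmul, ← Nat.cast_smul_eq_nsmul ℝ, smul_smul]
    congr 2
    field_simp
  have hdiff : Tendsto (fun m : ℕ => (m : ℝ) * ‖F (t / m) - G (t / m)‖) atTop (𝓝 0) := by
    have hd : HasDerivAt (fun h => F h - G h) 0 0 := by
      have := hF.sub hGd
      rwa [sub_self] at this
    have ho := hd.isLittleO
    simp only [h0, hG0, sub_self, sub_zero, smul_zero] at ho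
    have ho' := (ho.comp_tendsto htm).norm_left
    have hz := ho'.tendsto_div_nhds_zero
    have := hz.const_mul t
    rw [mul_zero] at this
    refine this.congr' ?_
    filter_upwards [eventually_gt_atTop 0] with m hm
    simp only [Function.comp]
    field_simp
  have hmain : Tendsto (fun m : ℕ => F (t / m) ^ m - G (t / m) ^ m) atTop (𝓝 0) := by
    have hz := hdiff.const_mul (Real.exp (c * t))
    rw [mul_zero] at hz
    refine squeeze_zero_norm' ?_ hz
    filter_upwards [htm.eventually hc₁, htm.eventually hc₂, eventually_gt_atTop 0] with m h1 h2 hm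
    have hpos : 0 < t / (m : ℝ) := by positivity
    have e1 : ‖F (t / m)‖ ≤ Real.exp (c * (t / m)) := (h1 hpos).trans <| by
      gcongr; exact (le_max_left _ _).trans (le_max_left _ _)
    have e2 : ‖G (t / m)‖ ≤ Real.exp (c * (t / m)) := (h2 hpos).trans <| by
      gcongr; exact (le_max_right _ _).trans (le_max_left _ _)
    have e3 : 1 ≤ Real.exp (c * (t / m)) := Real.one_le_exp (mul_nonneg (le_max_right _ _) hpos.le)
    refine (norm_pow_sub_pow_le e3 e1 e2 m).trans_eq ?_
    rw [← Real.exp_nat_mul, show (m : ℝ) * (c * (t / m)) = c * t by field_simp]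
    ring
  have := hmain.add (tendsto_const_nhds (x := NormedSpace.exp (t • A)))
  rw [zero_add] at this
  refine this.congr' ?_
  filter_upwards [hpowG] with m hm
  rw [hm, sub_add_cancel]

/-! ### The flow of a linear system -/

section
open scoped Matrix.Norms.Operator
variable {n : ℕ}

theorem hasDerivAt_exp_smul_mulVec (A : Matrix (Fin n) (Fin n) ℝ) (v : Fin n → ℝ) (t : ℝ) :
    HasDerivAt (fun s : ℝ => NormedSpace.exp (s • A) *ᵥ v)
      (A *ᵥ (NormedSpace.exp (t • A) *ᵥ v)) t := by
  have h := hasDerivAt_exp_smul_const' (𝕂 := ℝ) A t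
  let L : Matrix (Fin n) (Fin n) ℝ →L[ℝ] (Fin n → ℝ) :=
    LinearMap.toContinuousLinearMap ((Matrix.mulVecBilin ℝ ℝ).flip v)
  have := L.hasFDerivAt.comp_hasDerivAt t h
  rw [Matrix.mulVec_mulVec]
  exact this

theorem isLTISolution_exp (A : Matrix (Fin n) (Fin n) ℝ) (v : Fin n → ℝ) :
    IsLTISolution A v fun s : ℝ => NormedSpace.exp (s • A) *ᵥ v :=
  ⟨by simp, fun t _ => (hasDerivAt_exp_smul_mulVec A v t).hasDerivWithinAt⟩

theorem exp_mulVec_exp (A : Matrix (Fin n) (Fin n) ℝ) (s t : ℝ) (v : Fin n → ℝ) :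
    NormedSpace.exp (s • A) *ᵥ (NormedSpace.exp (t • A) *ᵥ v) =
      NormedSpace.exp ((s + t) • A) *ᵥ v := by
  rw [Matrix.mulVec_mulVec, add_smul, Matrix.exp_add_of_commute]
  exact ((Commute.refl A).smul_left s).smul_right t

theorem exp_neg_mulVec_exp (A : Matrix (Fin n) (Fin n) ℝ) (t : ℝ) (v : Fin n → ℝ) :
    NormedSpace.exp (t • -A) *ᵥ (NormedSpace.exp (t • A) *ᵥ v) = v := by
  rw [smul_neg, ← neg_smul, exp_mulVec_exp]
  simp

theorem IsLTISolution.eq_exp {A : Matrix (Fin n) (Fin n) ℝ} {v : Fin n → ℝ} {x : ℝ → Fin n → ℝ}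
    (hx : IsLTISolution A v x) {t : ℝ} (ht : 0 ≤ t) : x t = NormedSpace.exp (t • A) *ᵥ v := by
  let L := LinearMap.toContinuousLinearMap (Matrix.mulVecLin A)
  refine ODE_solution_unique_of_mem_Icc_right (v := fun _ y => A *ᵥ y) (s := fun _ => Set.univ)
    (K := ‖L‖₊) (a := 0) (b := t) ?_ ?_ ?_ (fun _ _ => trivial)
    (g := fun s : ℝ => NormedSpace.exp (s • A) *ᵥ v)
    ?_ ?_ (fun _ _ => trivial) ?_ (Set.right_mem_Icc.2 ht)
  · intro s _
    exact L.lipschitz.lipschitzOnWith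
  · intro s hs
    exact (hx.2 s hs.1).continuousWithinAt.mono Set.Icc_subset_Ici_self
  · intro s hs
    exact (hx.2 s hs.1).mono (Set.Ici_subset_Ici.2 hs.1)
  · intro s _
    exact (hasDerivAt_exp_smul_mulVec A v s).continuousAt.continuousWithinAt
  · intro s _
    exact (hasDerivAt_exp_smul_mulVec A v s).hasDerivWithinAt
  · simp [hx.1]

theorem analyticAt_exp_mulVec_apply (A : Matrix (Fin n) (Fin n) ℝ) (v : Fin n → ℝ) (i : Fin n)
    (t : ℝ) : AnalyticAt ℝ (fun s : ℝ => (NormedSpace.exp (s • A) *ᵥ v) i) t := by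
  let L : Matrix (Fin n) (Fin n) ℝ →L[ℝ] ℝ :=
    LinearMap.toContinuousLinearMap (LinearMap.proj i ∘ₗ (Matrix.mulVecBilin ℝ ℝ).flip v)
  have h1 : AnalyticAt ℝ (fun s : ℝ => s • A) t :=
    analyticAt_id.smul analyticAt_const
  have h2 : AnalyticAt ℝ (NormedSpace.exp : Matrix (Fin n) (Fin n) ℝ → _) (t • A) :=
    NormedSpace.exp_analytic (𝕂 := ℝ) _
  exact (L.analyticAt _).comp (AnalyticAt.comp (f := fun s : ℝ => s • A) h2 h1)

/-- A block of coordinates that receives nothing from the other coordinates and starts at zero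
stays at zero. -/
theorem exp_mulVec_apply_eq_zero {A : Matrix (Fin n) (Fin n) ℝ} {U : Set (Fin n)}
    (hA : ∀ i ∈ U, ∀ j ∉ U, A i j = 0) {v : Fin n → ℝ} (hv : ∀ i ∈ U, v i = 0) (t : ℝ)
    {i : Fin n} (hi : i ∈ U) : (NormedSpace.exp (t • A) *ᵥ v) i = 0 := by
  have hpow : ∀ m : ℕ, ∀ i ∈ U, ((t • A) ^ m *ᵥ v) i = 0 := by
    intro m
    induction m with
    | zero => simpa using hv
    | succ m ih =>
      intro i hi
      rw [pow_succ', ← Matrix.mulVec_mulVec]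
      change ∑ j, (t • A) i j * ((t • A) ^ m *ᵥ v) j = 0
      refine Finset.sum_eq_zero fun j _ => ?_
      by_cases hj : j ∈ U
      · simp [ih j hj]
      · simp [hA i hi j hj]
  let L : Matrix (Fin n) (Fin n) ℝ →L[ℝ] ℝ :=
    LinearMap.toContinuousLinearMap (LinearMap.proj i ∘ₗ (Matrix.mulVecBilin ℝ ℝ).flip v)
  have h := L.hasSum (NormedSpace.exp_series_hasSum_exp' (𝕂 := ℝ) (t • A))
  have h0 : ∀ m : ℕ, L ((m.factorial⁻¹ : ℝ) • (t • A) ^ m) = 0 := fun m => by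
    rw [map_smul]
    exact (congrArg _ (hpow m i hi)).trans (smul_zero _)
  simp only [h0] at h
  exact h.unique hasSum_zero

end

/-! ### Sign variations and alternations -/

section
variable {n : ℕ}

/-- The vector `x` has `k + 1` entries, at increasing positions, whose signs alternate, where `P`
says which reals count as carrying the sign `+`. With `P a ↔ 0 < a` this describes the sign
variations counted by `s⁻`; with `P a ↔ 0 ≤ a`, a zero may be read as either sign, as in `s⁺`. -/
def HasAlternation (P : ℝ → Prop) (x : Fin n → ℝ) (k : ℕ) : Prop :=
  ∃ s ∈ ({1, -1} : Set ℝ), ∃ f : Fin (k + 1) → Fin n, StrictMono f ∧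
    ∀ j : Fin (k + 1), P (s * (-1) ^ (j : ℕ) * x (f j))

theorem sign_mul_sq {s : ℝ} (hs : s ∈ ({1, -1} : Set ℝ)) (j : ℕ) :
    (s * (-1) ^ j) * (s * (-1) ^ j) = 1 := by
  rcases hs with rfl | rfl <;> rcases neg_one_pow_eq_or ℝ j with h | h <;> rw [h] <;> norm_num

theorem sign_mul_eq {s : ℝ} (hs : s ∈ ({1, -1} : Set ℝ)) (j : ℕ) :
    s * (-1) ^ j = 1 ∨ s * (-1) ^ j = -1 :=
  mul_self_eq_one_iff.1 (sign_mul_sq hs j)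

/-- The pairs of neighbouring opposite nonzero entries counted by `sMinus`. -/
def signChanges (x : Fin n → ℝ) : Set (Fin n × Fin n) :=
  {p | p.1 < p.2 ∧ x p.1 * x p.2 < 0 ∧ ∀ k, p.1 < k → k < p.2 → x k = 0}

theorem sMinus_eq_ncard (x : Fin n → ℝ) : sMinus x = (signChanges x).ncard := rfl

/-- Between two opposite entries there is a pair of neighbouring opposite entries: take the last
entry `a'` opposite to the right end, and then the first nonzero entry after it. -/
theorem exists_signChange {x : Fin n → ℝ} {a b : Fin n} (hab : a < b) (h : x a * x b < 0) :
    ∃ p ∈ signChanges x, a ≤ p.1 ∧ p.2 ≤ b := by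
  classical
  let S : Finset (Fin n) := {i | a ≤ i ∧ i < b ∧ x i * x b < 0}
  have hS : S.Nonempty := ⟨a, by simp [S, hab, h]⟩
  obtain ⟨ha1, ha2, ha3⟩ : a ≤ S.max' hS ∧ S.max' hS < b ∧ x (S.max' hS) * x b < 0 := by
    simpa [S] using S.max'_mem hS
  have hmax : ∀ i ∈ S, i ≤ S.max' hS := fun i hi => S.le_max' i hi
  generalize S.max' hS = a' at *
  let T : Finset (Fin n) := {i | a' < i ∧ i ≤ b ∧ x i ≠ 0}
  have hT : T.Nonempty := ⟨b, by simp [T, ha2]; rintro h0; simp [h0] at h⟩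
  obtain ⟨hb1, hb2, hb3⟩ : a' < T.min' hT ∧ T.min' hT ≤ b ∧ x (T.min' hT) ≠ 0 := by
    simpa [T] using T.min'_mem hT
  have hmin : ∀ i ∈ T, T.min' hT ≤ i := fun i hi => T.min'_le i hi
  generalize T.min' hT = b' at *
  refine ⟨(a', b'), ⟨hb1, ?_, fun k hk1 hk2 => ?_⟩, ha1, hb2⟩
  · have hb'b : 0 < x b' * x b := by
      rcases hb2.eq_or_lt with rfl | hlt
      · exact mul_self_pos.2 hb3
      · refine lt_of_le_of_ne (not_lt.1 fun hneg => ?_) (mul_ne_zero hb3 ?_).symm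
        · exact absurd (hmax b' (by simp [S, hlt, hneg, ha1.trans hb1.le])) (not_le.2 hb1)
        · rintro h0; simp [h0] at h
    change x a' * x b' < 0
    by_contra hcon
    rw [not_lt] at hcon
    nlinarith [mul_nonneg hcon hb'b.le, mul_neg_of_neg_of_pos ha3 (mul_self_pos.2 hb3)]
  · by_contra hk
    exact absurd (hmin k (by simp [T, hk, hk1]; exact hk2.le.trans hb2)) (not_le.2 hk2)

/-- Each two consecutive entries of an alternation enclose a sign change, and these are distinct. -/
theorem le_sMinus_of_hasAlternation {x : Fin n → ℝ} {k : ℕ} (h : HasAlternation (0 < ·) x k) :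
    k ≤ sMinus x := by
  obtain ⟨s, hs, f, hf, hpos⟩ := h
  have step : ∀ j : Fin k, ∃ p ∈ signChanges x, f j.castSucc ≤ p.1 ∧ p.2 ≤ f j.succ := by
    intro j
    refine exists_signChange (hf j.castSucc_lt_succ) ?_
    have h1 := hpos j.castSucc
    have h2 := hpos j.succ
    simp only [Fin.val_castSucc, Fin.val_succ, pow_succ] at h1 h2
    nlinarith [mul_pos h1 h2, sign_mul_sq hs j]
  choose p hp hp1 hp2 using step
  have hmono : StrictMono fun j => (p j).1 := by
    intro i j hij
    calc (p i).1 < (p i).2 := (hp i).1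
      _ ≤ f i.succ := hp2 i
      _ ≤ f j.castSucc := hf.monotone (by simpa [Fin.le_def] using hij)
      _ ≤ (p j).1 := hp1 j
  have hinj : Function.Injective p := fun i j hij => hmono.injective (congrArg Prod.fst hij)
  rw [sMinus_eq_ncard]
  calc k = (Set.range p).ncard := by
        rw [Set.ncard_range_of_injective hinj, Nat.card_fin]
    _ ≤ _ := Set.ncard_le_ncard (Set.range_subset_iff.2 hp) (Set.toFinite _)

/-- Strong induction along the positions: if `x b ≠ 0`, the sign changes up to `b` are realised by
an alternation that ends at `b`. -/
theorem exists_alternation_ending_at (x : Fin n → ℝ) (b : Fin n) (hb : x b ≠ 0) :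
    ∃ f : ℕ → Fin n, ∃ k : ℕ, f k = b ∧ k = {p ∈ signChanges x | p.2 ≤ b}.ncard ∧
      ∀ j < k, f j < f (j + 1) ∧ x (f j) * x (f (j + 1)) < 0 := by
  classical
  induction b using WellFoundedLT.induction with
  | _ b ih =>
  let S : Finset (Fin n) := {i | i < b ∧ x i ≠ 0}
  by_cases hS : S.Nonempty
  · obtain ⟨hab, ha⟩ : S.max' hS < b ∧ x (S.max' hS) ≠ 0 := by
      simpa [S] using S.max'_mem hS
    have hmax : ∀ i < b, x i ≠ 0 → i ≤ S.max' hS := fun i h1 h2 => S.le_max' i (by simp [S, h1, h2])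
    generalize S.max' hS = a at *
    obtain ⟨f, k, hfk, hk, hf⟩ := ih a hab ha
    have hzero : ∀ i, a < i → i < b → x i = 0 := fun i h1 h2 => by
      by_contra h0
      exact absurd (hmax i h2 h0) (not_le.2 h1)
    -- a sign change that ends after `a` and up to `b` can only be `(a, b)`
    have hlast : ∀ p ∈ signChanges x, p.2 ≤ b → ¬ p.2 ≤ a → p = (a, b) := by
      rintro ⟨p, q⟩ ⟨h1, h2, h3⟩ hqb hqa
      simp only at *
      have hp0 : x p ≠ 0 := by rintro h0; simp [h0] at h2
      have hq0 : x q ≠ 0 := by rintro h0; simp [h0] at h2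
      have hq : q = b := by
        by_contra hne
        exact hq0 (hzero q (not_le.1 hqa) (lt_of_le_of_ne hqb hne))
      subst hq
      have hpa := hmax p h1 hp0
      have : p = a := by
        by_contra hne
        exact ha (h3 a (lt_of_le_of_ne hpa hne) hab)
      rw [this]
    rcases lt_or_gt_of_ne (mul_ne_zero ha hb) with hneg | hpos
    · refine ⟨fun j => if j ≤ k then f j else b, k + 1, by simp, ?_, ?_⟩
      · have : {p ∈ signChanges x | p.2 ≤ b} = insert (a, b) {p ∈ signChanges x | p.2 ≤ a} := by
          ext p
          simp only [Set.mem_insert_iff, Set.mem_ofPred_eq]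
          constructor
          · rintro ⟨h1, h2⟩
            by_cases h3 : p.2 ≤ a
            · exact Or.inr ⟨h1, h3⟩
            · exact Or.inl (hlast p h1 h2 h3)
          · rintro (rfl | ⟨h1, h2⟩)
            · exact ⟨⟨hab, hneg, hzero⟩, le_rfl⟩
            · exact ⟨h1, h2.trans hab.le⟩
        rw [this, Set.ncard_insert_of_notMem (fun h => absurd h.2 (not_le.2 hab)) (Set.toFinite _),
          ← hk]
      · intro j hj
        rcases (Nat.lt_succ_iff.1 hj).eq_or_lt with rfl | hlt
        · simpa [hfk] using ⟨hab, hneg⟩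
        · simpa [hlt.le, Nat.succ_le_of_lt hlt] using hf j hlt
    · refine ⟨fun j => if j < k then f j else b, k, by simp, ?_, ?_⟩
      · have : {p ∈ signChanges x | p.2 ≤ b} = {p ∈ signChanges x | p.2 ≤ a} := by
          ext p
          simp only [Set.mem_ofPred_eq]
          refine and_congr_right fun h1 => ⟨fun h2 => ?_, fun h2 => h2.trans hab.le⟩
          by_contra h3
          have := hlast p h1 h2 h3
          subst this
          exact absurd h1.2.1 (not_lt.2 hpos.le)
        rw [this, ← hk]
      · intro j hj
        obtain ⟨h1, h2⟩ := hf j hj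
        rcases (Nat.succ_le_of_lt hj).eq_or_lt with heq | hlt
        · have hfa : f (j + 1) = a := by rw [← hfk, ← heq]
          rw [hfa] at h1 h2
          have hnot : ¬ j + 1 < k := by omega
          simp only [hj, hnot, if_true, if_false]
          refine ⟨h1.trans hab, ?_⟩
          by_contra hcon
          rw [not_lt] at hcon
          nlinarith [mul_nonneg hcon hpos.le, mul_neg_of_neg_of_pos h2 (mul_self_pos.2 hb)]
        · have hlt' : j + 1 < k := hlt
          simpa [hj, hlt'] using ⟨h1, h2⟩
  · refine ⟨fun _ => b, 0, rfl, ?_, by simp⟩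
    symm
    rw [Set.ncard_eq_zero (Set.toFinite _), Set.eq_empty_iff_forall_notMem]
    rintro ⟨p, q⟩ ⟨⟨h1, h2, -⟩, hqb⟩
    refine hS ⟨p, ?_⟩
    have hp0 : x p ≠ 0 := by rintro h0; simp [h0] at h2
    simpa [S, hp0] using h1.trans_le hqb

theorem hasAlternation_sMinus {x : Fin n → ℝ} (hx : x ≠ 0) :
    HasAlternation (0 < ·) x (sMinus x) := by
  classical
  let S : Finset (Fin n) := {i | x i ≠ 0}
  have hS : S.Nonempty := by
    obtain ⟨i, hi⟩ := Function.ne_iff.1 hx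
    exact ⟨i, by simpa [S] using hi⟩
  have hb : x (S.max' hS) ≠ 0 := by simpa [S] using S.max'_mem hS
  obtain ⟨f, k, hfk, hk, hf⟩ := exists_alternation_ending_at x (S.max' hS) hb
  have hk' : k = sMinus x := by
    rw [hk, sMinus_eq_ncard]
    congr 1
    ext p
    refine ⟨fun h => h.1, fun h => ⟨h, S.le_max' _ ?_⟩⟩
    have : x p.2 ≠ 0 := by
      intro h0
      have := h.2.1
      simp [h0] at this
    simpa [S] using this
  rw [← hk']
  have h0 : x (f 0) ≠ 0 := by
    rcases Nat.eq_zero_or_pos k with rfl | hkpos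
    · rwa [hfk]
    · intro h0
      have := (hf 0 hkpos).2
      simp [h0] at this
  obtain ⟨s, hs, hs0⟩ : ∃ s ∈ ({1, -1} : Set ℝ), 0 < s * x (f 0) := by
    rcases lt_or_gt_of_ne h0 with h | h
    · exact ⟨-1, by simp, by linarith⟩
    · exact ⟨1, by simp, by linarith⟩
  refine ⟨s, hs, fun j => f j, Fin.strictMono_iff_lt_succ.2 fun j => by simpa using (hf j j.2).1,
    fun j => ?_⟩
  have hall : ∀ j ≤ k, 0 < s * (-1) ^ j * x (f j) := by
    intro j
    induction j with
    | zero => simpa using hs0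
    | succ j ih =>
      intro hj
      have h1 := ih (by omega)
      have h2 := (hf j (by omega)).2
      have h3 : 0 < s * (-1) ^ (j + 1) * x (f (j + 1)) * (s * (-1) ^ j * x (f j)) := by
        have e : s * (-1) ^ (j + 1) * x (f (j + 1)) * (s * (-1) ^ j * x (f j)) =
            -((s * (-1) ^ j) * (s * (-1) ^ j)) * (x (f j) * x (f (j + 1))) := by ring
        rw [e, sign_mul_sq hs]
        linarith
      exact pos_of_mul_pos_left h3 h1.le
  exact hall j (Nat.lt_succ_iff.1 j.2)

theorem hasAlternation_sPlus {x : Fin n → ℝ} (hx : x ≠ 0) :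
    HasAlternation (0 ≤ ·) x (sPlus x) := by
  have hn : Nonempty (Fin n) := by
    obtain ⟨i, -⟩ := Function.ne_iff.1 hx
    exact ⟨i⟩
  obtain ⟨e, -, he⟩ := Finset.exists_mem_eq_sup (Finset.univ : Finset (Fin n → ℤˣ))
    Finset.univ_nonempty fun e => sMinus (fillZeros x e)
  have hne : fillZeros x e ≠ 0 := by
    obtain ⟨i, hi⟩ := Function.ne_iff.1 hx
    refine Function.ne_iff.2 ⟨i, ?_⟩
    have : fillZeros x e i = x i := if_neg hi
    rw [this]
    exact hi
  obtain ⟨s, hs, f, hf, hpos⟩ := hasAlternation_sMinus hne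
  rw [sPlus, he]
  refine ⟨s, hs, f, hf, fun j => ?_⟩
  have := hpos j
  simp only [fillZeros] at this
  split_ifs at this with h0
  · simp [h0]
  · exact this.le

theorem le_sPlus_of_hasAlternation {x : Fin n → ℝ} {k : ℕ} (h : HasAlternation (0 ≤ ·) x k) :
    k ≤ sPlus x := by
  classical
  obtain ⟨s, hs, f, hf, hpos⟩ := h
  -- every zero entry `x (f j)` is filled with the sign that the alternation prescribes
  let e : Fin n → ℤˣ := fun i =>
    if ∃ j : Fin (k + 1), f j = i ∧ s * (-1) ^ (j : ℕ) = 1 then 1 else -1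
  refine (le_sMinus_of_hasAlternation (x := fillZeros x e) ⟨s, hs, f, hf, fun j => ?_⟩).trans
    (Finset.le_sup (f := fun e => sMinus (fillZeros x e)) (Finset.mem_univ e))
  have hj := hpos j
  simp only [fillZeros]
  split_ifs with h0
  · rcases sign_mul_eq hs (j : ℕ) with h1 | h1
    · have : ∃ j' : Fin (k + 1), f j' = f j ∧ s * (-1) ^ (j' : ℕ) = 1 := ⟨j, rfl, h1⟩
      simp [e, this, h1]
    · have : ¬ ∃ j' : Fin (k + 1), f j' = f j ∧ s * (-1) ^ (j' : ℕ) = 1 := by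
        rintro ⟨j', h2, h3⟩
        rw [hf.injective h2, h1] at h3
        norm_num at h3
      simp [e, this, h1]
  · refine lt_of_le_of_ne hj (mul_ne_zero ?_ h0).symm
    exact left_ne_zero_of_mul_eq_one (sign_mul_sq hs j)

/-- The key combinatorial step: adding to one entry a nonnegative multiple of an adjacent entry
creates no new alternation. If the altered entry `i` owes its sign to the adjacent entry `i'`,
the alternation can be moved from `i` to `i'`. -/
theorem HasAlternation.of_add_adjacent {P : ℝ → Prop} (hP : ∀ a, 0 < a → P a)
    (hP' : ∀ a b, P a → a ≤ b → P b) (hP0 : ∀ a, P a → 0 ≤ a) {v w : Fin n → ℝ} {i i' : Fin n}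
    (hii' : i ≠ i') (hadj : ∀ m, m ≠ i → m ≠ i' → (m < i ↔ m < i')) {c : ℝ} (hc : 0 ≤ c)
    (hi : v i = w i + c * w i') (hne : ∀ m, m ≠ i → v m = w m) {k : ℕ}
    (h : HasAlternation P v k) : HasAlternation P w k := by
  classical
  obtain ⟨s, hs, f, hf, hpos⟩ := h
  by_cases hgood : ∀ j : Fin (k + 1), P (s * (-1) ^ (j : ℕ) * w (f j))
  · exact ⟨s, hs, f, hf, hgood⟩
  push Not at hgood
  obtain ⟨j₀, hj₀⟩ := hgood
  have hfj₀ : f j₀ = i := by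
    by_contra hcon
    exact hj₀ (hne _ hcon ▸ hpos j₀)
  have hw : 0 < s * (-1) ^ (j₀ : ℕ) * w i' := by
    by_contra hcon
    refine hj₀ (hP' _ _ (hpos j₀) ?_)
    rw [hfj₀, hi]
    nlinarith [mul_nonneg hc (sub_nonneg.2 (not_lt.1 hcon))]
  -- the alternation does not use `i'` next to `i`, since the entry there has the wrong sign
  have hfree : ∀ j : Fin (k + 1), f j = i' → (j : ℕ) + 1 ≠ j₀ ∧ (j₀ : ℕ) + 1 ≠ j := by
    intro j hj
    have h1 := hP0 _ (hpos j)
    rw [hj, hne i' hii'.symm] at h1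
    constructor
    · intro h2
      rw [← h2, pow_succ] at hw
      nlinarith
    · intro h2
      rw [← h2, pow_succ] at h1
      nlinarith
  refine ⟨s, hs, Function.update f j₀ i', Fin.strictMono_iff_lt_succ.2 fun j => ?_, fun j => ?_⟩
  · have hlt : f j.castSucc < f j.succ := hf j.castSucc_lt_succ
    have hjj : j.castSucc ≠ j.succ := j.castSucc_lt_succ.ne
    by_cases h1 : j.castSucc = j₀
    · have h2 : j.succ ≠ j₀ := fun h => hjj (h1.trans h.symm)
      rw [Function.update_of_ne h2, h1, Function.update_self]
      rw [h1, hfj₀] at hlt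
      have h3 : f j.succ ≠ i' := fun h => (hfree _ h).2 (by simp [← h1])
      have := hadj _ hlt.ne' h3
      exact lt_of_le_of_ne (not_lt.1 fun h => absurd (this.2 h) hlt.not_gt) h3.symm
    · by_cases h2 : j.succ = j₀
      · rw [Function.update_of_ne h1, h2, Function.update_self]
        rw [h2, hfj₀] at hlt
        have h3 : f j.castSucc ≠ i' := fun h => (hfree _ h).1 (by simp [← h2])
        exact (hadj _ hlt.ne h3).1 hlt
      · rwa [Function.update_of_ne h1, Function.update_of_ne h2]
  · by_cases h1 : j = j₀
    · rw [h1, Function.update_self]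
      exact hP _ hw
    · rw [Function.update_of_ne h1, ← hne]
      · exact hpos j
      · rw [← hfj₀]
        exact fun h => h1 (hf.injective h)
end

/-! ### Matrices generated by a monoid of matrices -/

section
open scoped Matrix.Norms.Operator
variable {n : ℕ}

/-- `B` is the velocity at `1` of a curve of matrices that, for small positive times, runs inside
the monoid `Q`. -/
def IsTangent (Q : Submonoid (Matrix (Fin n) (Fin n) ℝ)) (B : Matrix (Fin n) (Fin n) ℝ) : Prop :=
  ∃ F : ℝ → Matrix (Fin n) (Fin n) ℝ, F 0 = 1 ∧ HasDerivAt F B 0 ∧ ∀ᶠ h in 𝓝[>] (0 : ℝ), F h ∈ Q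

theorem IsTangent.zero (Q : Submonoid (Matrix (Fin n) (Fin n) ℝ)) : IsTangent Q 0 :=
  ⟨fun _ => 1, rfl, hasDerivAt_const _ _, Eventually.of_forall fun _ => Q.one_mem⟩

theorem IsTangent.add {Q : Submonoid (Matrix (Fin n) (Fin n) ℝ)} {B C : Matrix (Fin n) (Fin n) ℝ}
    (hB : IsTangent Q B) (hC : IsTangent Q C) : IsTangent Q (B + C) := by
  obtain ⟨F, hF0, hF, hFQ⟩ := hB
  obtain ⟨G, hG0, hG, hGQ⟩ := hC
  refine ⟨fun h => F h * G h, by simp [hF0, hG0], ?_, ?_⟩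
  · have := hF.mul hG
    rwa [hF0, hG0, mul_one, one_mul] at this
  · filter_upwards [hFQ, hGQ] with h h1 h2 using Q.mul_mem h1 h2

theorem IsTangent.sum {Q : Submonoid (Matrix (Fin n) (Fin n) ℝ)} {ι : Type*} (s : Finset ι)
    {B : ι → Matrix (Fin n) (Fin n) ℝ} (hB : ∀ i ∈ s, IsTangent Q (B i)) :
    IsTangent Q (∑ i ∈ s, B i) :=
  Finset.sum_induction _ _ (fun _ _ => IsTangent.add) (IsTangent.zero Q) hB

/-- Tangent matrices are closed under sums, so tangency may be tested entry by entry. -/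
theorem IsTangent.of_single {Q : Submonoid (Matrix (Fin n) (Fin n) ℝ)}
    {A : Matrix (Fin n) (Fin n) ℝ} (h : ∀ i j, IsTangent Q (Matrix.single i j (A i j))) :
    IsTangent Q A := by
  rw [Matrix.matrix_eq_sum_single A]
  exact IsTangent.sum _ fun i _ => IsTangent.sum _ fun j _ => h i j

/-- The exponential of a tangent matrix is a limit of products of elements of the monoid. -/
theorem IsTangent.exp_mem_closure [Nonempty (Fin n)] {Q : Submonoid (Matrix (Fin n) (Fin n) ℝ)}
    {B : Matrix (Fin n) (Fin n) ℝ} (hB : IsTangent Q B) {t : ℝ} (ht : 0 < t) :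
    NormedSpace.exp (t • B) ∈ closure (Q : Set (Matrix (Fin n) (Fin n) ℝ)) := by
  obtain ⟨F, hF0, hF, hFQ⟩ := hB
  refine mem_closure_of_tendsto (tendsto_pow_exp_of_hasDerivAt hF0 hF ht) ?_
  have htm : Tendsto (fun m : ℕ => t / (m : ℝ)) atTop (𝓝[>] 0) := by
    refine tendsto_nhdsWithin_iff.2 ⟨tendsto_const_div_atTop_nhds_zero_nat t, ?_⟩
    filter_upwards [eventually_gt_atTop 0] with m hm
    exact div_pos ht (Nat.cast_pos.2 hm)
  filter_upwards [htm.eventually hFQ] with m hm using Q.pow_mem hm m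

theorem isTangent_of_one_add_smul {Q : Submonoid (Matrix (Fin n) (Fin n) ℝ)}
    {B : Matrix (Fin n) (Fin n) ℝ} (h : ∀ᶠ h in 𝓝[>] (0 : ℝ), 1 + h • B ∈ Q) : IsTangent Q B := by
  refine ⟨fun h => 1 + h • B, by simp, ?_, h⟩
  have := ((hasDerivAt_id (0 : ℝ)).smul_const B).const_add 1
  rw [one_smul] at this
  exact this

end

/-! ### Alternations along the flow of a Jacobi matrix -/

section
variable {n : ℕ}

/-- The matrices that create no alternation. -/
def alternationReflecting (n : ℕ) (P : ℝ → Prop) : Submonoid (Matrix (Fin n) (Fin n) ℝ) where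
  carrier := {M | ∀ v k, HasAlternation P (M *ᵥ v) k → HasAlternation P v k}
  one_mem' := fun v k h => by simpa using h
  mul_mem' := fun {M N} hM hN v k h => hN _ _ (hM _ _ (by simpa [Matrix.mulVec_mulVec] using h))

/-- The matrices that destroy no alternation. -/
def alternationPreserving (n : ℕ) (P : ℝ → Prop) : Submonoid (Matrix (Fin n) (Fin n) ℝ) where
  carrier := {M | ∀ v k, HasAlternation P v k → HasAlternation P (M *ᵥ v) k}
  one_mem' := fun v k h => by simpa using h
  mul_mem' := fun {M N} hM hN v k h => by
    have := hM _ _ (hN _ _ h)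
    rwa [Matrix.mulVec_mulVec] at this

theorem one_add_smul_single_mulVec (h c : ℝ) (i j : Fin n) (v : Fin n → ℝ) (m : Fin n) :
    ((1 + h • Matrix.single i j c) *ᵥ v) m = v m + if m = i then h * c * v j else 0 := by
  rw [Matrix.add_mulVec, Matrix.one_mulVec, Pi.add_apply, Matrix.smul_single, Matrix.single_mulVec]
  split_ifs with hm
  · subst hm; simp
  · simp [hm]

theorem eventually_one_add_mul_pos (c : ℝ) : ∀ᶠ h in 𝓝[>] (0 : ℝ), 0 < 1 + h * c := by
  have : Tendsto (fun h : ℝ => 1 + h * c) (𝓝 0) (𝓝 1) := by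
    have : Continuous fun h : ℝ => 1 + h * c := by fun_prop
    simpa using this.tendsto 0
  exact (this.mono_left nhdsWithin_le_nhds).eventually (lt_mem_nhds one_pos)

theorem HasAlternation.of_mul {P : ℝ → Prop} (hP : ∀ a b, 0 < b → P (b * a) → P a)
    {v w : Fin n → ℝ} (h : ∀ i, ∃ b > 0, v i = b * w i) {k : ℕ} (hv : HasAlternation P v k) :
    HasAlternation P w k := by
  obtain ⟨s, hs, f, hf, hpos⟩ := hv
  refine ⟨s, hs, f, hf, fun j => ?_⟩
  obtain ⟨b, hb, hv⟩ := h (f j)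
  refine hP _ b hb ?_
  have := hpos j
  rw [hv] at this
  convert this using 1
  ring

theorem IsJacobi.isTangent_reflecting {A : Matrix (Fin n) (Fin n) ℝ} (hA : IsJacobi A) :
    IsTangent (alternationReflecting n (0 < ·)) A := by
  refine IsTangent.of_single fun i j => ?_
  by_cases hij : i = j
  · subst hij
    refine isTangent_of_one_add_smul ?_
    filter_upwards [eventually_one_add_mul_pos (A i i)] with h hh v k hv
    refine hv.of_mul (fun a b hb h => pos_of_mul_pos_right h hb.le) fun m => ?_
    rw [one_add_smul_single_mulVec]
    by_cases hm : m = i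
    · exact ⟨_, hh, by rw [if_pos hm, hm]; ring⟩
    · exact ⟨1, one_pos, by simp [hm]⟩
  by_cases hadj : (i : ℕ) + 1 = j ∨ (j : ℕ) + 1 = i
  · have hpos : 0 < A i j := hadj.elim (fun h => (hA.2 i j h.symm).1) fun h => (hA.2 j i h.symm).2
    refine isTangent_of_one_add_smul ?_
    filter_upwards [self_mem_nhdsWithin] with h hh v k hv
    refine hv.of_add_adjacent (fun _ => id) (fun _ _ => lt_of_lt_of_le) (fun _ => le_of_lt)
      (i := i) (i' := j) (c := h * A i j) hij (fun m _ _ => ?_) (mul_pos hh hpos).le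
      ?_ fun m hm => ?_
    · omega
    · rw [one_add_smul_single_mulVec, if_pos rfl]
    · rw [one_add_smul_single_mulVec, if_neg hm, add_zero]
  · rw [hA.1 i j (by omega), Matrix.single_zero]
    exact IsTangent.zero _

/-- The inverse elementary steps are covered by `HasAlternation.of_add_adjacent` as well: `v` arises
from `(1 - h A_ij E_ij) v` by adding a nonnegative multiple of the adjacent entry. -/
theorem IsJacobi.isTangent_preserving {A : Matrix (Fin n) (Fin n) ℝ} (hA : IsJacobi A) :
    IsTangent (alternationPreserving n (0 ≤ ·)) (-A) := by
  refine IsTangent.of_single fun i j => ?_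
  rw [Matrix.neg_apply]
  by_cases hij : i = j
  · subst hij
    refine isTangent_of_one_add_smul ?_
    filter_upwards [eventually_one_add_mul_pos (-A i i)] with h hh v k hv
    refine hv.of_mul (fun a b hb h => nonneg_of_mul_nonneg_right h hb) fun m => ?_
    rw [one_add_smul_single_mulVec]
    by_cases hm : m = i
    · refine ⟨_, inv_pos.2 hh, ?_⟩
      rw [if_pos hm, hm, eq_comm, inv_mul_eq_iff_eq_mul₀ hh.ne']
      ring
    · exact ⟨1, one_pos, by simp [hm]⟩
  by_cases hadj : (i : ℕ) + 1 = j ∨ (j : ℕ) + 1 = i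
  · have hpos : 0 < A i j := hadj.elim (fun h => (hA.2 i j h.symm).1) fun h => (hA.2 j i h.symm).2
    refine isTangent_of_one_add_smul ?_
    filter_upwards [self_mem_nhdsWithin] with h hh v k hv
    refine hv.of_add_adjacent (fun _ => le_of_lt) (fun _ _ => le_trans) (fun _ => id)
      (i := i) (i' := j) (c := h * A i j) hij (fun m _ _ => ?_) (mul_pos hh hpos).le
      ?_ fun m hm => ?_
    · omega
    · rw [one_add_smul_single_mulVec, if_pos rfl, one_add_smul_single_mulVec, if_neg (Ne.symm hij)]
      ring
    · rw [one_add_smul_single_mulVec, if_neg hm, add_zero]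
  · rw [hA.1 i j (by omega), neg_zero, Matrix.single_zero]
    exact IsTangent.zero _

theorem isOpen_hasAlternation (k : ℕ) : IsOpen {x : Fin n → ℝ | HasAlternation (0 < ·) x k} := by
  simp only [HasAlternation, Set.ofPred_exists, ← exists_prop]
  refine isOpen_iUnion fun s => isOpen_iUnion fun _ => isOpen_iUnion fun f =>
    isOpen_iUnion fun _ => ?_
  simp only [Set.ofPred_forall]
  exact isOpen_iInter_of_finite fun j => isOpen_lt continuous_const (by fun_prop)

theorem isClosed_hasAlternation (k : ℕ) :
    IsClosed {x : Fin n → ℝ | HasAlternation (0 ≤ ·) x k} := by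
  have : {x : Fin n → ℝ | HasAlternation (0 ≤ ·) x k} =
      ⋃ s ∈ ({1, -1} : Set ℝ), ⋃ f ∈ {f : Fin (k + 1) → Fin n | StrictMono f},
        {x | ∀ j : Fin (k + 1), 0 ≤ s * (-1) ^ (j : ℕ) * x (f j)} := by
    ext x
    simp only [HasAlternation, Set.mem_iUnion, Set.mem_ofPred_eq, exists_prop]
  rw [this]
  refine (Set.toFinite _).isClosed_biUnion fun s _ =>
    (Set.toFinite _).isClosed_biUnion fun f _ => ?_
  simp only [Set.ofPred_forall]
  exact isClosed_iInter fun j => isClosed_le continuous_const (by fun_prop)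

theorem IsJacobi.hasAlternation_of_exp [Nonempty (Fin n)] {A : Matrix (Fin n) (Fin n) ℝ}
    (hA : IsJacobi A) {t : ℝ} (ht : 0 < t) {v : Fin n → ℝ} {k : ℕ}
    (h : HasAlternation (0 < ·) (NormedSpace.exp (t • A) *ᵥ v) k) : HasAlternation (0 < ·) v k := by
  have hcl := hA.isTangent_reflecting.exp_mem_closure ht
  have hcont : Continuous fun M : Matrix (Fin n) (Fin n) ℝ => M *ᵥ v := by fun_prop
  obtain ⟨M, hM, hMQ⟩ := mem_closure_iff.1 hcl _ ((isOpen_hasAlternation k).preimage hcont) h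
  exact hMQ v k hM

theorem IsJacobi.hasAlternation_exp_neg [Nonempty (Fin n)] {A : Matrix (Fin n) (Fin n) ℝ}
    (hA : IsJacobi A) {t : ℝ} (ht : 0 < t) {v : Fin n → ℝ} {k : ℕ}
    (h : HasAlternation (0 ≤ ·) v k) :
    HasAlternation (0 ≤ ·) (NormedSpace.exp (t • -A) *ᵥ v) k := by
  have hcl := hA.isTangent_preserving.exp_mem_closure ht
  have hcont : Continuous fun M : Matrix (Fin n) (Fin n) ℝ => M *ᵥ v := by fun_prop
  have hsub : (alternationPreserving n (0 ≤ ·) : Set (Matrix (Fin n) (Fin n) ℝ)) ⊆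
      {M | HasAlternation (0 ≤ ·) (M *ᵥ v) k} := fun M hM => hM v k h
  exact closure_minimal hsub ((isClosed_hasAlternation k).preimage hcont) hcl

end

/-! ### Zeros that persist to first order -/

section
variable {n : ℕ}

/-- A zero entry of `y` at which `A y` vanishes too cannot have neighbours of only one sign. -/
theorem IsJacobi.exists_opposite_neighbor {A : Matrix (Fin n) (Fin n) ℝ} (hA : IsJacobi A)
    {y : Fin n → ℝ} {i m : Fin n} (hi : y i = 0) (hAi : (A *ᵥ y) i = 0)
    (hm : (i : ℕ) + 1 = m ∨ (m : ℕ) + 1 = i) (hym : y m ≠ 0) :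
    ∃ m' : Fin n, ((i : ℕ) + 1 = m' ∨ (m' : ℕ) + 1 = i) ∧ y m * y m' < 0 := by
  by_contra! hcon
  have hpos : ∀ l : Fin n, ((i : ℕ) + 1 = l ∨ (l : ℕ) + 1 = i) → 0 < A i l := fun l hl =>
    hl.elim (fun h => (hA.2 i l h.symm).1) fun h => (hA.2 l i h.symm).2
  have hsum : ∑ l, y m * (A i l * y l) = 0 := by
    rw [← Finset.mul_sum]
    exact mul_eq_zero_of_right _ hAi
  refine absurd hsum (Finset.sum_pos' (fun l _ => ?_) ⟨m, Finset.mem_univ m, ?_⟩).ne'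
  · by_cases hl : (i : ℕ) + 1 = l ∨ (l : ℕ) + 1 = i
    · rw [mul_left_comm]
      exact mul_nonneg (hpos l hl).le (hcon l hl)
    · by_cases hil : i = l
      · simp [← hil, hi]
      · rw [hA.1 i l (by omega)]
        simp
  · rw [mul_left_comm]
    exact mul_pos (hpos m hm) (mul_self_pos.2 hym)

/-- If `A y` vanishes wherever `y` does, then a zero entry with only zero neighbours propagates to
all positions. -/
theorem IsJacobi.eq_zero_of_zero_neighbors {A : Matrix (Fin n) (Fin n) ℝ} (hA : IsJacobi A)
    {y : Fin n → ℝ} (hy : ∀ i, y i = 0 → (A *ᵥ y) i = 0) {i : Fin n} (hi : y i = 0)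
    (hnb : ∀ m : Fin n, ((i : ℕ) + 1 = m ∨ (m : ℕ) + 1 = i) → y m = 0) : y = 0 := by
  have step : ∀ i j : Fin n, ((i : ℕ) + 1 = j ∨ (j : ℕ) + 1 = i) →
      (y i = 0 ∧ ∀ m : Fin n, ((i : ℕ) + 1 = m ∨ (m : ℕ) + 1 = i) → y m = 0) →
      (y j = 0 ∧ ∀ m : Fin n, ((j : ℕ) + 1 = m ∨ (m : ℕ) + 1 = j) → y m = 0) := by
    rintro i j hij ⟨h1, h2⟩
    refine ⟨h2 j hij, fun m hm => ?_⟩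
    by_contra hym
    obtain ⟨m', hm', hneg⟩ := hA.exists_opposite_neighbor (h2 j hij) (hy j (h2 j hij)) hm hym
    have hmi : (m : ℕ) ≠ i := fun h => hym (Fin.ext h ▸ h1)
    have hmm : (m : ℕ) ≠ m' := fun h => by
      rw [Fin.ext h] at hneg
      exact absurd hneg (not_lt.2 (mul_self_nonneg _))
    have hm'i : m' = i := Fin.ext (by omega)
    rw [hm'i, h1, mul_zero] at hneg
    exact lt_irrefl _ hneg
  have up : ∀ d : ℕ, ∀ j : Fin n, (j : ℕ) = i + d ∨ (j : ℕ) + d = i →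
      (y j = 0 ∧ ∀ m : Fin n, ((j : ℕ) + 1 = m ∨ (m : ℕ) + 1 = j) → y m = 0) := by
    intro d
    induction d with
    | zero =>
      intro j hj
      have : j = i := Fin.ext (by omega)
      exact this ▸ ⟨hi, hnb⟩
    | succ d ih =>
      rintro j (hj | hj)
      · exact step ⟨i + d, by omega⟩ j (by simp only; omega) (ih _ (by simp))
      · exact step ⟨j + 1, by omega⟩ j (by simp) (ih _ (by simp only; omega))
  funext j
  rcases le_total (i : ℕ) j with h | h
  · exact (up (j - i) j (by omega)).1
  · exact (up (i - j) j (by omega)).1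

/-- If `A y` vanishes wherever `y` does, and `y ≠ 0`, then every zero of `y` lies between two
entries of opposite signs, so that `s⁺` and `s⁻` agree on `y`: an alternation that uses a zero can
be moved to the neighbour of the required sign. -/
theorem IsJacobi.hasAlternation_pos_of_nonneg {A : Matrix (Fin n) (Fin n) ℝ} (hA : IsJacobi A)
    {y : Fin n → ℝ} (hy0 : y ≠ 0) (hy : ∀ i, y i = 0 → (A *ᵥ y) i = 0) {k : ℕ}
    (h : HasAlternation (0 ≤ ·) y k) : HasAlternation (0 < ·) y k := by
  obtain ⟨s, hs, f, hf, hpos⟩ := h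
  have hiso : ∀ i m : Fin n, ((i : ℕ) + 1 = m ∨ (m : ℕ) + 1 = i) → y i = 0 → y m ≠ 0 := by
    intro i m him hi hm
    refine hy0 (hA.eq_zero_of_zero_neighbors hy hi fun l hl => ?_)
    by_contra hyl
    obtain ⟨m', hm', hneg⟩ := hA.exists_opposite_neighbor hi (hy i hi) hl hyl
    have hll : (l : ℕ) ≠ m := fun h => hyl (Fin.ext h ▸ hm)
    have hlm : (l : ℕ) ≠ m' := fun h => by
      rw [Fin.ext h] at hneg
      exact absurd hneg (not_lt.2 (mul_self_nonneg _))
    have hm'm : m' = m := Fin.ext (by omega)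
    rw [hm'm, hm, mul_zero] at hneg
    exact lt_irrefl _ hneg
  have hmove : ∀ j : Fin (k + 1), ∃ g : Fin n, 0 < s * (-1) ^ (j : ℕ) * y g ∧
      (g = f j ∨ y (f j) = 0 ∧ ((f j : ℕ) + 1 = g ∨ (g : ℕ) + 1 = f j)) := by
    intro j
    have hsj : s * (-1) ^ (j : ℕ) ≠ 0 := left_ne_zero_of_mul_eq_one (sign_mul_sq hs j)
    by_cases h0 : y (f j) = 0
    · have hex : ∃ m : Fin n, ((f j : ℕ) + 1 = m ∨ (m : ℕ) + 1 = f j) ∧ y m ≠ 0 := by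
        by_contra! hcon
        exact hy0 (hA.eq_zero_of_zero_neighbors hy h0 hcon)
      obtain ⟨m, hm, hym⟩ := hex
      obtain ⟨m', hm', hneg⟩ := hA.exists_opposite_neighbor h0 (hy _ h0) hm hym
      rcases lt_or_gt_of_ne (mul_ne_zero hsj hym) with hlt | hgt
      · refine ⟨m', ?_, Or.inr ⟨h0, hm'⟩⟩
        have e : s * (-1) ^ (j : ℕ) * y m * (s * (-1) ^ (j : ℕ) * y m') < 0 := by
          rw [mul_mul_mul_comm, sign_mul_sq hs, one_mul]
          exact hneg
        exact pos_of_mul_neg_right e hlt.le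
      · exact ⟨m, hgt, Or.inr ⟨h0, hm⟩⟩
    · exact ⟨f j, lt_of_le_of_ne (hpos j) (mul_ne_zero hsj h0).symm, Or.inl rfl⟩
  choose g hg hgf using hmove
  refine ⟨s, hs, g, Fin.strictMono_iff_lt_succ.2 fun j => ?_, hg⟩
  have hlt : f j.castSucc < f j.succ := hf j.castSucc_lt_succ
  have hne : (g j.castSucc : ℕ) ≠ g j.succ := by
    intro heq
    have h1 := hg j.castSucc
    have h2 := hg j.succ
    rw [Fin.ext heq] at h1
    simp only [Fin.val_castSucc, Fin.val_succ, pow_succ] at h1 h2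
    linarith
  rw [Fin.lt_def] at hlt ⊢
  by_contra hge
  -- the two entries can only cross if both have been moved, from adjacent zeros
  rcases hgf j.castSucc with h1 | ⟨h1, h1'⟩ <;> rcases hgf j.succ with h2 | ⟨h2, h2'⟩
  · omega
  · omega
  · omega
  · exact hiso _ _ (by omega) h1 h2

/-! ### Variation diminution along the flow of a Jacobi matrix -/

theorem IsJacobi.sPlus_exp_le {A : Matrix (Fin n) (Fin n) ℝ} (hA : IsJacobi A) {v : Fin n → ℝ}
    (hv : v ≠ 0) {t : ℝ} (ht : 0 < t) : sPlus (NormedSpace.exp (t • A) *ᵥ v) ≤ sMinus v := by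
  have hn : Nonempty (Fin n) := by
    obtain ⟨i, -⟩ := Function.ne_iff.1 hv
    exact ⟨i⟩
  set x : ℝ → Fin n → ℝ := fun s => NormedSpace.exp (s • A) *ᵥ v with hx
  have hx0 : ∀ s, x s ≠ 0 := fun s h => hv <| by
    rw [← exp_neg_mulVec_exp A s v]
    exact (congrArg _ h).trans (Matrix.mulVec_zero _)
  -- by analyticity, shortly before `t` an entry vanishes only if it vanishes near `t` identically,
  -- and then its derivative vanishes too
  have hreg : ∀ᶠ s in 𝓝[<] t, ∀ i, x s i = 0 → (A *ᵥ x s) i = 0 := by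
    refine eventually_all.2 fun i => ?_
    rcases (analyticAt_exp_mulVec_apply A v i t).eventually_eq_zero_or_eventually_ne_zero with h | h
    · refine nhdsWithin_le_nhds (h.eventually_nhds.mono fun s hs _ => ?_)
      have h1 : HasDerivAt (fun s => x s i) ((A *ᵥ x s) i) s :=
        hasDerivAt_pi.1 (hasDerivAt_exp_smul_mulVec A v s) i
      exact h1.unique ((hasDerivAt_const s (0 : ℝ)).congr_of_eventuallyEq hs)
    · exact (h.filter_mono (nhdsWithin_mono _ fun s hs => ne_of_lt hs)).mono
        fun s hs h0 => absurd h0 hs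
  obtain ⟨r, hr, hr0, hrt⟩ := (hreg.and (Ioo_mem_nhdsLT ht)).exists
  have h1 : HasAlternation (0 ≤ ·) (x r) (sPlus (x t)) := by
    have := hA.hasAlternation_exp_neg (sub_pos.2 hrt) (hasAlternation_sPlus (hx0 t))
    have e : NormedSpace.exp ((t - r) • -A) *ᵥ x t = x r := by
      rw [hx, smul_neg, ← neg_smul]
      simp only [exp_mulVec_exp]
      congr 3
      ring
    rwa [e] at this
  exact le_sMinus_of_hasAlternation
    (hA.hasAlternation_of_exp hr0 (hA.hasAlternation_pos_of_nonneg (hx0 r) hr h1))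

/-! ### Necessity of the Jacobi form -/

theorem hasAlternation_one {P : ℝ → Prop} {x : Fin n → ℝ} {i j : Fin n} (hij : i ≠ j)
    (hi : P (x i)) (hj : P (-x j)) : HasAlternation P x 1 := by
  rcases lt_or_gt_of_ne hij with h | h
  · refine ⟨1, by simp, ![i, j], Fin.strictMono_iff_lt_succ.2 fun l => ?_, fun l => ?_⟩
    · fin_cases l; simpa using h
    · fin_cases l <;> simpa
  · refine ⟨-1, by simp, ![j, i], Fin.strictMono_iff_lt_succ.2 fun l => ?_, fun l => ?_⟩
    · fin_cases l; simpa using h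
    · fin_cases l <;> simpa

theorem hasAlternation_two {P : ℝ → Prop} {x : Fin n → ℝ} {i k j : Fin n}
    (hikj : i < k ∧ k < j ∨ j < k ∧ k < i) (hi : P (x i)) (hk : P (-x k)) (hj : P (x j)) :
    HasAlternation P x 2 := by
  rcases hikj with ⟨h, h'⟩ | ⟨h, h'⟩
  · refine ⟨1, by simp, ![i, k, j], Fin.strictMono_iff_lt_succ.2 fun l => ?_, fun l => ?_⟩
    · fin_cases l <;> simpa
    · fin_cases l <;> simpa
  · refine ⟨1, by simp, ![j, k, i], Fin.strictMono_iff_lt_succ.2 fun l => ?_, fun l => ?_⟩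
    · fin_cases l <;> simpa
    · fin_cases l <;> simpa

/-- A nonzero vector supported on `S` has at most `#S - 1` sign variations. -/
theorem sMinus_lt_of_card_support_le {x : Fin n → ℝ} (hx : x ≠ 0) {S : Finset (Fin n)}
    (hS : ∀ i, x i ≠ 0 → i ∈ S) : sMinus x < S.card := by
  obtain ⟨s, -, f, hf, hpos⟩ := hasAlternation_sMinus hx
  have := Finset.card_le_card_of_injOn (s := Finset.univ) (t := S) f
    (fun j _ => hS _ (right_ne_zero_of_mul (hpos j).ne')) hf.injective.injOn
  simpa using this

/-- An entry that is positive, or zero with positive derivative, is positive for small times. -/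
theorem eventually_exp_mulVec_pos {A : Matrix (Fin n) (Fin n) ℝ} {v : Fin n → ℝ} {i : Fin n}
    (h : 0 < v i ∨ v i = 0 ∧ 0 < (A *ᵥ v) i) :
    ∀ᶠ t in 𝓝[>] (0 : ℝ), 0 < (NormedSpace.exp (t • A) *ᵥ v) i := by
  have hd : HasDerivAt (fun t : ℝ => (NormedSpace.exp (t • A) *ᵥ v) i) ((A *ᵥ v) i) 0 := by
    have := hasDerivAt_pi.1 (hasDerivAt_exp_smul_mulVec A v 0) i
    simpa using this
  rcases h with h | ⟨h0, h⟩
  · refine nhdsWithin_le_nhds (hd.continuousAt.eventually (lt_mem_nhds ?_))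
    simpa using h
  · have := (hasDerivAt_iff_tendsto_slope.1 hd).mono_left
      (nhdsWithin_mono 0 fun t (ht : t ∈ Set.Ioi (0 : ℝ)) => ht.ne')
    filter_upwards [this.eventually (lt_mem_nhds h), self_mem_nhdsWithin] with t ht ht0
    rw [slope_def_field] at ht
    simp only [zero_smul, NormedSpace.exp_zero, Matrix.one_mulVec, h0, sub_zero] at ht
    exact (div_pos_iff_of_pos_right ht0).1 ht

theorem eventually_exp_mulVec_neg {A : Matrix (Fin n) (Fin n) ℝ} {v : Fin n → ℝ} {i : Fin n}
    (h : v i < 0 ∨ v i = 0 ∧ (A *ᵥ v) i < 0) :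
    ∀ᶠ t in 𝓝[>] (0 : ℝ), (NormedSpace.exp (t • A) *ᵥ v) i < 0 := by
  have := eventually_exp_mulVec_pos (A := A) (v := -v) (i := i)
    (by simpa [Matrix.mulVec_neg] using h)
  simpa [Matrix.mulVec_neg] using this

theorem offDiag_nonneg_of_sPlus_exp_le {A : Matrix (Fin n) (Fin n) ℝ}
    (hvar : ∀ v : Fin n → ℝ, v ≠ 0 → ∀ t : ℝ, 0 < t →
      sPlus (NormedSpace.exp (t • A) *ᵥ v) ≤ sMinus v) {i j : Fin n} (hij : i ≠ j) : 0 ≤ A i j := by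
  by_contra! hneg
  have hv : (Pi.single j 1 : Fin n → ℝ) ≠ 0 := by simp
  have e1 := eventually_exp_mulVec_pos (A := A) (v := Pi.single j 1) (i := j) (by simp)
  have e2 := eventually_exp_mulVec_neg (A := A) (v := Pi.single j 1) (i := i) (by simp [hij, hneg])
  obtain ⟨t, ⟨h1, h2⟩, ht⟩ := ((e1.and e2).and self_mem_nhdsWithin).exists
  have h3 := le_sPlus_of_hasAlternation
    (hasAlternation_one (P := (0 ≤ ·)) hij.symm h1.le (neg_nonneg.2 h2.le))
  have h4 := sMinus_lt_of_card_support_le hv (S := {j}) fun l hl => by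
    by_contra h; simp at h; simp [h] at hl
  have := hvar _ hv t ht
  simp at h4
  omega

/-- Entries with an index `k` strictly between row and column vanish: otherwise `e_j - c e_k` would
gain a sign variation. -/
theorem apply_eq_zero_of_sPlus_exp_le {A : Matrix (Fin n) (Fin n) ℝ}
    (hvar : ∀ v : Fin n → ℝ, v ≠ 0 → ∀ t : ℝ, 0 < t →
      sPlus (NormedSpace.exp (t • A) *ᵥ v) ≤ sMinus v) {i k j : Fin n}
    (hikj : i < k ∧ k < j ∨ j < k ∧ k < i) : A i j = 0 := by
  have hij : i ≠ j := by omega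
  have hik : i ≠ k := by omega
  have hkj : k ≠ j := by omega
  by_contra hne
  have hpos : 0 < A i j := lt_of_le_of_ne (offDiag_nonneg_of_sPlus_exp_le hvar hij) (Ne.symm hne)
  have hnn : 0 ≤ A i k := offDiag_nonneg_of_sPlus_exp_le hvar hik
  -- `c` is chosen so small that the `i`-th entry of `A v` is still positive
  let c := A i j / (A i k + 1)
  have hc : 0 < c := by positivity
  have hcA : c * A i k < A i j := by
    rw [div_mul_eq_mul_div, div_lt_iff₀ (by positivity)]
    nlinarith
  let v : Fin n → ℝ := Pi.single j 1 - Pi.single k c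
  have hvi : v i = 0 := by simp [v, hij, hik]
  have hvj : v j = 1 := by simp [v, hkj.symm]
  have hvk : v k = -c := by simp [v, hkj]
  have hAv : (A *ᵥ v) i = A i j - c * A i k := by
    simp [v, Matrix.mulVec_sub, mul_comm]
  have hv : v ≠ 0 := fun h => by simp [h] at hvj
  have e1 := eventually_exp_mulVec_pos (A := A) (v := v) (i := j) (by simp [hvj])
  have e2 := eventually_exp_mulVec_neg (A := A) (v := v) (i := k) (by simp [hvk, hc])
  have e3 := eventually_exp_mulVec_pos (A := A) (v := v) (i := i)
    (Or.inr ⟨hvi, by rw [hAv]; linarith⟩)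
  obtain ⟨t, ⟨⟨h1, h2⟩, h3⟩, ht⟩ := (((e1.and e2).and e3).and self_mem_nhdsWithin).exists
  have h4 := le_sPlus_of_hasAlternation
    (hasAlternation_two (P := (0 ≤ ·)) hikj h3.le (neg_nonneg.2 h2.le) h1.le)
  have h5 := sMinus_lt_of_card_support_le hv (S := {j, k}) fun l hl => by
    by_contra h
    simp only [Finset.mem_insert, Finset.mem_singleton, not_or] at h
    simp [v, h.1, h.2] at hl
  rw [Finset.card_pair hkj.symm] at h5
  have := hvar _ hv t ht
  omega

theorem apply_eq_zero_of_far {A : Matrix (Fin n) (Fin n) ℝ}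
    (hvar : ∀ v : Fin n → ℝ, v ≠ 0 → ∀ t : ℝ, 0 < t →
      sPlus (NormedSpace.exp (t • A) *ᵥ v) ≤ sMinus v) {i j : Fin n}
    (hij : (i : ℕ) + 1 < j ∨ (j : ℕ) + 1 < i) : A i j = 0 := by
  rcases hij with h | h
  · exact apply_eq_zero_of_sPlus_exp_le hvar (k := ⟨i + 1, by omega⟩)
      (Or.inl ⟨Fin.lt_def.2 (by simp), Fin.lt_def.2 h⟩)
  · exact apply_eq_zero_of_sPlus_exp_le hvar (k := ⟨j + 1, by omega⟩)
      (Or.inr ⟨Fin.lt_def.2 (by simp), Fin.lt_def.2 h⟩)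

theorem apply_pos_of_sPlus_exp_le {A : Matrix (Fin n) (Fin n) ℝ}
    (hvar : ∀ v : Fin n → ℝ, v ≠ 0 → ∀ t : ℝ, 0 < t →
      sPlus (NormedSpace.exp (t • A) *ᵥ v) ≤ sMinus v) {i j : Fin n}
    (hadj : (i : ℕ) + 1 = j ∨ (j : ℕ) + 1 = i) : 0 < A i j := by
  have hij : i ≠ j := by omega
  refine lt_of_le_of_ne (offDiag_nonneg_of_sPlus_exp_le hvar hij) fun h0 => ?_
  have hv : (Pi.single j 1 : Fin n → ℝ) ≠ 0 := by simp
  have hzero : ∀ m l : Fin n, (m : ℕ) + 1 < l ∨ (l : ℕ) + 1 < m → A m l = 0 :=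
    fun m l => apply_eq_zero_of_far hvar
  -- the positions on the side of `i` form a block that receives nothing from the side of `j`
  have hblock : ∀ t : ℝ, (NormedSpace.exp (t • A) *ᵥ Pi.single j 1) i = 0 := by
    intro t
    have hs : ∀ m ∈ {m : Fin n | i < j ∧ m < j ∨ j < i ∧ j < m}, m ≠ j := by
      rintro m (h | h) <;> omega
    refine exp_mulVec_apply_eq_zero (U := {m | i < j ∧ m < j ∨ j < i ∧ j < m})
      (fun m hm l hl => ?_) (fun m hm => by simp [hs m hm]) t ?_
    · simp only [Set.mem_ofPred_eq, Fin.lt_def] at hm hl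
      by_cases hfar : (m : ℕ) + 1 < l ∨ (l : ℕ) + 1 < m
      · exact hzero m l hfar
      · obtain rfl : m = i := Fin.ext (by omega)
        obtain rfl : l = j := Fin.ext (by omega)
        exact h0.symm
    · simp only [Set.mem_ofPred_eq, Fin.lt_def]
      omega
  have e1 := eventually_exp_mulVec_pos (A := A) (v := Pi.single j 1) (i := j) (by simp)
  obtain ⟨t, h1, ht⟩ := (e1.and self_mem_nhdsWithin).exists
  have h3 := le_sPlus_of_hasAlternation
    (hasAlternation_one (P := (0 ≤ ·)) hij.symm h1.le (by simp [hblock t]))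
  have h4 := sMinus_lt_of_card_support_le hv (S := {j}) fun l hl => by
    by_contra h; simp at h; simp [h] at hl
  have := hvar _ hv t ht
  simp at h4
  omega

theorem isJacobi_of_sPlus_exp_le {A : Matrix (Fin n) (Fin n) ℝ}
    (hvar : ∀ v : Fin n → ℝ, v ≠ 0 → ∀ t : ℝ, 0 < t →
      sPlus (NormedSpace.exp (t • A) *ᵥ v) ≤ sMinus v) : IsJacobi A := by
  refine ⟨fun i j => apply_eq_zero_of_far hvar, fun i j hij =>
    ⟨apply_pos_of_sPlus_exp_le hvar (Or.inl hij.symm),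
    apply_pos_of_sPlus_exp_le hvar (Or.inr hij.symm)⟩⟩
end

theorem mainTheorem3 {n : ℕ} (A : Matrix (Fin n) (Fin n) ℝ) :
    IsJacobi A ↔
      ∀ x₀ : Fin n → ℝ, x₀ ≠ 0 →
        ∀ x : ℝ → Fin n → ℝ, IsLTISolution A x₀ x →
          ∀ t : ℝ, 0 < t → sPlus (x t) ≤ sMinus x₀ := by
  refine ⟨fun hA x₀ hx₀ x hx t ht => ?_, fun h => ?_⟩
  · rw [hx.eq_exp ht.le]
    exact hA.sPlus_exp_le hx₀ ht
  · exact isJacobi_of_sPlus_exp_le fun v hv t ht => h v hv _ (isLTISolution_exp A v) t ht
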